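/- Let $(\mathcal X,d)$ be a complete separable metric space, let $K\ge 2$, $[K]=\{1,\dots,K\}$, and let $\mu_1,\dots,\mu_K$ be finite positive Borel measures on $\mathcal X$. Let $c:\mathcal X\times\mathcal X\to[0,\infty]$ be lower semicontinuous with $c(x,x)=0$ for all $x\in\mathcal X$, and such that whenever $\{x_n\}$ is a bounded sequence in $(\mathcal X,d)$ and $\{x_n'\}$ is a sequence in $\mathcal X$ with $\sup_n c(x_n',x_n)<\infty$, the set $\{(x_n',x_n):n\in\mathbb N\}$ is relatively compact in $\mathcal X\times\mathcal X$. For finite positive Borel measures $\nu,\rho$ on $\mathcal X$ let $C(\nu,\rho)=\inf_\pi\int c(x',x)\,d\pi(x',x)$, the infimum being over positive measures $\pi$ on $\mathcal X\times\mathcal X$ with first marginal $\nu$ and second marginal $\rho$ (so $C(\nu,\rho)=+\infty$ if there is none). The generalized barycenter value is $$B^*_\mu=\inf\Big\{\lambda(\mathcal X)+\sum_{i\in[K]}C(\tilde\mu_i,\mu_i)\ :\ \lambda,\tilde\mu_1,\dots,\tilde\mu_K \text{ finite positive Borel measures on } \mathcal X,\ \tilde\mu_i\le\lambda \text{ for all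 } i\in[K]\Big\}.$$ For $f\in C_b(\mathcal X)$ put $f^c(x)=\inf_{x'\in\mathcal X}\{f(x')+c(x',x)\}$. For nonempty $A\subseteq[K]$ put $c_A(x_1,\dots,x_K)=\inf_{x'\in\mathcal X}\sum_{i\in A}c(x',x_i)$. For $\vec x\in\mathcal X^K$ and $\vec r\in[0,1]^K$ put $$\tilde c(\vec x,\vec r)=\inf\Big\{\sum_{\emptyset\ne A\subseteq[K]}m_A\,(c_A(\vec x)+1)\ :\ m_A\in[0,\infty),\ \sum_{A\ni i}m_A=r_i \text{ for all } i\in[K]\Big\},\qquad 0\cdot\infty:=0 .$$ Then for every $f\in C_b(\mathcal X)$ the function $f^c$ is real-valued and $\mu_i$-integrable for every $i$, and there is no duality gap: each of the following three suprema equals $B^*_\mu$. 1. $\displaystyle \sup\sum_{i\in[K]}\int_{\mathcal X} f_i^c\,d\mu_i$ over $f_1,\dots,f_K\in C_b(\mathcal X)$ with $f_i\ge0$ for all $i$ and $\sum_{i\in[K]}f_i\le1$ on $\mathcal X$; 2. $\displaystyle \sup\sum_{i\in[K]}\int_{\mathcal X} g_i\,d\mu_i$ over $g_1,\dots,g_K\in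 C_b(\mathcal X)$ with $\sum_{i\in A}g_i(x_i)\le1+c_A(x_1,\dots,x_K)$ for all $(x_1,\dots,x_K)\in\mathcal X^K$ and all nonempty $A\subseteq[K]$; 3. $\displaystyle \sup\sum_{i\in[K]}\int_{\mathcal X} h_i\,d\mu_i$ over $h_1,\dots,h_K\in C_b(\mathcal X)$ with $\sum_{i\in[K]}r_ih_i(x_i)\le\tilde c(\vec x,\vec r)$ for all $(\vec x,\vec r)\in\mathcal X^K\times[0,1]^K$. -/

import Mathlib

open MeasureTheory
open scoped ENNReal NNReal

noncomputable section

/-- Standing assumption on a cost `c : X × X → [0,∞]`. The first argument of `c` is the perturbed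
point, the second one is the data point. -/
structure IsAdmissibleCost {X : Type*} [MetricSpace X] (c : X → X → ℝ≥0∞) : Prop where
  lsc : LowerSemicontinuous fun p : X × X => c p.1 p.2
  self_eq_zero : ∀ x, c x x = 0
  precompact : ∀ x x' : ℕ → X, Bornology.IsBounded (Set.range x) →
    (⨆ n, c (x' n) (x n)) < ∞ → IsCompact (closure (Set.range fun n => (x' n, x n)))

/-- Optimal transport cost `C(ν, μ)`: infimum of `∫ c(x', x) dπ(x', x)` over the positive measures
`π` with first marginal `ν` and second marginal `μ` (equal to `∞` if there are none). -/
def transportCost {X : Type*} [MeasurableSpace X] (c : X → X → ℝ≥0∞) (ν μ : Measure X) : ℝ≥0∞ :=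
  ⨅ (π : Measure (X × X)) (_ : π.map Prod.fst = ν ∧ π.map Prod.snd = μ),
    ∫⁻ p, c p.1 p.2 ∂π

/-- Value of the generalized barycenter problem: infimum of `λ(X) + ∑ i, C(μ̃ i, μ i)` over finite
positive measures `λ`, `μ̃ i` with `μ̃ i ≤ λ` for all `i`. -/
def barycenterValue {X : Type*} [MeasurableSpace X] {K : ℕ} (c : X → X → ℝ≥0∞)
    (μ : Fin K → Measure X) : ℝ≥0∞ :=
  ⨅ (lam : FiniteMeasure X) (ν : Fin K → FiniteMeasure X)
    (_ : ∀ i, (ν i : Measure X) ≤ (lam : Measure X)),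
    (lam : Measure X) Set.univ + ∑ i, transportCost c (ν i : Measure X) (μ i)

/-- The `c`-transform `f^c(x) = inf_{x'} (f(x') + c(x', x))`. -/
def cTransform {X : Type*} (c : X → X → ℝ≥0∞) (f : X → ℝ) (x : X) : EReal :=
  ⨅ x' : X, ((f x' : ℝ) : EReal) + ((c x' x : ℝ≥0∞) : EReal)

/-- `c_A(x_1, …, x_K) = inf_{x'} ∑_{i ∈ A} c(x', x_i)`. -/
def groupCost {X : Type*} {K : ℕ} (c : X → X → ℝ≥0∞) (A : Finset (Fin K)) (x : Fin K → X) : ℝ≥0∞ :=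
  ⨅ x' : X, ∑ i ∈ A, c x' (x i)

/-- `S_K`, the nonempty subsets of `[K]`. -/
abbrev NonemptySubsets (K : ℕ) : Type := {A : Finset (Fin K) // A.Nonempty}

/-- `c̃((x_1, r_1), …, (x_K, r_K))`: the infimum of `∑_A m_A (c_A(x) + 1)` over nonnegative weights
`m` on the nonempty subsets of `[K]` with `∑_{A ∋ i} m_A = r_i` for all `i`; here `0 * ∞ = 0`. -/
def fullCost {X : Type*} {K : ℕ} (c : X → X → ℝ≥0∞) (x : Fin K → X) (r : Fin K → unitInterval) :
    ℝ≥0∞ :=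
  ⨅ (m : NonemptySubsets K → ℝ≥0)
    (_ : ∀ i, ∑ A : NonemptySubsets K with i ∈ A.1, (m A : ℝ) = (r i : ℝ)),
    ∑ A : NonemptySubsets K, (m A : ℝ≥0∞) * (groupCost c A.1 x + 1)

/-- Feasible set of the dual of the generalized barycenter problem. -/
def IsBarycenterDualFeasible {X : Type*} [TopologicalSpace X] {K : ℕ}
    (f : Fin K → BoundedContinuousFunction X ℝ) : Prop :=
  (∀ i x, 0 ≤ f i x) ∧ ∀ x, ∑ i, f i x ≤ 1

/-- Value of the dual of the generalized barycenter problem. -/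
def barycenterDualValue {X : Type*} [TopologicalSpace X] [MeasurableSpace X] {K : ℕ}
    (c : X → X → ℝ≥0∞) (μ : Fin K → Measure X) : EReal :=
  ⨆ (f : Fin K → BoundedContinuousFunction X ℝ) (_ : IsBarycenterDualFeasible f),
    ((∑ i, ∫ x, (cTransform c (f i) x).toReal ∂(μ i) : ℝ) : EReal)

/-- Feasible set of the dual of the decomposed multimarginal problem. -/
def IsDecomposedDualFeasible {X : Type*} [TopologicalSpace X] {K : ℕ} (c : X → X → ℝ≥0∞)
    (g : Fin K → BoundedContinuousFunction X ℝ) : Prop :=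
  ∀ A : Finset (Fin K), A.Nonempty → ∀ x : Fin K → X,
    ((∑ i ∈ A, g i (x i) : ℝ) : EReal) ≤ ((1 + groupCost c A x : ℝ≥0∞) : EReal)

/-- Value of the dual of the decomposed multimarginal problem. -/
def decomposedDualValue {X : Type*} [TopologicalSpace X] [MeasurableSpace X] {K : ℕ}
    (c : X → X → ℝ≥0∞) (μ : Fin K → Measure X) : EReal :=
  ⨆ (g : Fin K → BoundedContinuousFunction X ℝ) (_ : IsDecomposedDualFeasible c g),
    ((∑ i, ∫ x, g i x ∂(μ i) : ℝ) : EReal)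

/-- Feasible set of the dual of the full multimarginal problem with cost `c̃`. -/
def IsFullDualFeasible {X : Type*} [TopologicalSpace X] {K : ℕ} (c : X → X → ℝ≥0∞)
    (h : Fin K → BoundedContinuousFunction X ℝ) : Prop :=
  ∀ (x : Fin K → X) (r : Fin K → unitInterval),
    ((∑ i, (r i : ℝ) * h i (x i) : ℝ) : EReal) ≤ ((fullCost c x r : ℝ≥0∞) : EReal)

/-- Value of the dual of the full multimarginal problem with cost `c̃`. -/
def fullDualValue {X : Type*} [TopologicalSpace X] [MeasurableSpace X] {K : ℕ}
    (c : X → X → ℝ≥0∞) (μ : Fin K → Measure X) : EReal :=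
  ⨆ (h : Fin K → BoundedContinuousFunction X ℝ) (_ : IsFullDualFeasible c h),
    ((∑ i, ∫ x, h i x ∂(μ i) : ℝ) : EReal)

end

/-! The values close up in a cycle `barycenterDualValue` ≤ `decomposedDualValue` ≤ `barycenterValue`
≤ `barycenterDualValue`; the full and the decomposed duals have the same feasible set
(`isFullDualFeasible_iff`).

For the first inequality, `f^c` is feasible for the decomposed dual except for continuity. It is
lower semicontinuous, so on the proper space `X` it is approximated from below by compactly
supported functions. For the second, a feasible `g` yields potentials `F i x' = sup_x (g i x)⁺ - c
x' x`, measurable and of sum at most 1, which are integrated against any competitor.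

The third is strong duality. Dual constraints perturbed by `u`, `w` and homogenized by `s` form a
convex cone. If `D` bounds the dual, the gap `s * D - ∑ ∫ φ i` is nonnegative on its unperturbed
part, and M. Riesz's theorem extends it positively (`exists_extension_dualGap`). By
Riesz–Markov–Kakutani the extension is given, up to sign, by measures `lam` on `X` and `π i` on `X ×
X` (`exists_measures_of_dual_bound`). Special tuples show that they form a competitor of value at
most `D`. Mass of `π i` could only be lost at infinity in the second marginal; compactness of the
sets `{x ∈ B, c x' x ≤ M}` excludes this (`integral_le_lintegral_snd`). -/

noncomputable section

open Filter Topology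
open scoped CompactlySupported

/-! ### Approximation of lower semicontinuous functions from below -/

/-- The inf-convolution of `min c n` with `n` times the distance. -/
def lipschitzMinorant {Y : Type*} [PseudoMetricSpace Y] (c : Y → ℝ≥0∞) (n : ℕ) (y : Y) : ℝ≥0∞ :=
  ⨅ z, min (c z) n + n * edist z y

section Approximation

variable {Y : Type*} [PseudoMetricSpace Y] (c : Y → ℝ≥0∞)

theorem lipschitzMinorant_le_min (n : ℕ) (y : Y) : lipschitzMinorant c n y ≤ min (c y) n :=
  (iInf_le _ y).trans (by simp)

theorem lipschitzMinorant_le (n : ℕ) (y : Y) : lipschitzMinorant c n y ≤ c y :=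
  (lipschitzMinorant_le_min c n y).trans (min_le_left _ _)

theorem lipschitzMinorant_ne_top (n : ℕ) (y : Y) : lipschitzMinorant c n y ≠ ∞ :=
  ne_top_of_le_ne_top (ENNReal.natCast_ne_top n)
    ((lipschitzMinorant_le_min c n y).trans (min_le_right _ _))

theorem lipschitzMinorant_le_add (n : ℕ) (y y' : Y) :
    lipschitzMinorant c n y ≤ lipschitzMinorant c n y' + n * edist y y' := by
  unfold lipschitzMinorant
  rw [ENNReal.iInf_add]
  refine le_iInf fun z => (iInf_le _ z).trans ?_
  rw [add_assoc, ← mul_add]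
  gcongr
  rw [edist_comm y y']
  exact edist_triangle _ _ _

theorem lipschitzWith_toReal_lipschitzMinorant (n : ℕ) :
    LipschitzWith n fun y => (lipschitzMinorant c n y).toReal := by
  refine LipschitzWith.of_le_add_mul _ fun y y' => ?_
  have h := lipschitzMinorant_le_add c n y y'
  have hfin : (n : ℝ≥0∞) * edist y y' ≠ ∞ :=
    ENNReal.mul_ne_top (ENNReal.natCast_ne_top n) (edist_ne_top _ _)
  have h2 := ENNReal.toReal_mono
    (ENNReal.add_ne_top.2 ⟨lipschitzMinorant_ne_top c n y', hfin⟩) h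
  rwa [ENNReal.toReal_add (lipschitzMinorant_ne_top c n y') hfin, ENNReal.toReal_mul,
    ← dist_edist, ENNReal.toReal_natCast] at h2

/-- For `t < c y`, lower semicontinuity keeps `c z` above `t` near `y`, and away from `y` the
penalty `n * edist z y` exceeds `t` for large `n`. -/
theorem tendsto_lipschitzMinorant {c : Y → ℝ≥0∞} (hc : LowerSemicontinuous c) (y : Y) :
    Tendsto (fun n => lipschitzMinorant c n y) atTop (𝓝 (c y)) := by
  refine tendsto_order.2 ⟨fun a ha => ?_, fun a ha =>
    Eventually.of_forall fun n => (lipschitzMinorant_le c n y).trans_lt ha⟩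
  obtain ⟨t, hat, hty⟩ := exists_between ha
  have htop : t ≠ ∞ := hty.ne_top
  obtain ⟨δ, hδ, hball⟩ := EMetric.mem_nhds_iff.1 (hc y t hty)
  obtain ⟨N₁, hN₁⟩ := ENNReal.exists_nat_mul_gt hδ.ne' htop
  obtain ⟨N₂, hN₂⟩ := ENNReal.exists_nat_gt htop
  filter_upwards [eventually_ge_atTop N₁, eventually_ge_atTop N₂] with n h₁ h₂
  refine hat.trans_le (le_iInf fun z => ?_)
  by_cases hz : edist z y < δ
  · exact (le_min (hball hz).le (hN₂.le.trans (by exact_mod_cast h₂))).trans le_self_add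
  · refine (hN₁.le.trans ?_).trans le_add_self
    gcongr
    exact not_lt.1 hz

end Approximation

theorem exists_compactlySupported_eq_one {Y : Type*} [TopologicalSpace Y] [R1Space Y]
    [LocallyCompactSpace Y] {s : Set Y} (hs : IsCompact s) :
    ∃ χ : C_c(Y, ℝ), (∀ y ∈ s, χ y = 1) ∧ (∀ y, 0 ≤ χ y) ∧ ∀ y, χ y ≤ 1 := by
  obtain ⟨f, h1, h2, -, h3⟩ :=
    exists_continuousMap_one_of_isCompact_subset_isOpen hs isOpen_univ (Set.subset_univ s)
  exact ⟨⟨f, h2⟩, fun y hy => h1 hy, fun y => (h3 y).1, fun y => (h3 y).2⟩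

/-- The product of a continuous function and a compactly supported one. -/
def cutoff {Y : Type*} [TopologicalSpace Y] (χ : C_c(Y, ℝ)) (g : C(Y, ℝ)) : C_c(Y, ℝ) where
  toContinuousMap := g * χ.toContinuousMap
  hasCompactSupport' := χ.hasCompactSupport.mul_left

@[simp] theorem cutoff_apply {Y : Type*} [TopologicalSpace Y] (χ : C_c(Y, ℝ)) (g : C(Y, ℝ))
    (y : Y) : cutoff χ g y = g y * χ y := rfl

/-- A nonnegative lower semicontinuous function on a proper metric space is a pointwise limit of
compactly supported continuous minorants. -/
theorem exists_seq_compactlySupported_tendsto {Y : Type*} [PseudoMetricSpace Y] [ProperSpace Y]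
    {c : Y → ℝ≥0∞} (hc : LowerSemicontinuous c) :
    ∃ g : ℕ → C_c(Y, ℝ), (∀ n y, 0 ≤ g n y) ∧ (∀ n y, ENNReal.ofReal (g n y) ≤ c y) ∧
      ∀ y, Tendsto (fun n => ENNReal.ofReal (g n y)) atTop (𝓝 (c y)) := by
  let T := CompactExhaustion.choice Y
  choose χ hχ1 hχ0 hχle using fun n => exists_compactlySupported_eq_one (T.isCompact n)
  refine ⟨fun n => cutoff (χ n)
    ⟨_, (lipschitzWith_toReal_lipschitzMinorant c n).continuous⟩, fun n y => ?_, fun n y => ?_,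
    fun y => ?_⟩
  · exact mul_nonneg ENNReal.toReal_nonneg (hχ0 n y)
  · refine le_trans ?_ (lipschitzMinorant_le c n y)
    refine ENNReal.ofReal_le_of_le_toReal ?_
    exact mul_le_of_le_one_right ENNReal.toReal_nonneg (hχle n y)
  · refine (tendsto_lipschitzMinorant hc y).congr' ?_
    obtain ⟨N, hN⟩ := T.exists_mem y
    filter_upwards [eventually_ge_atTop N] with n hn
    simp [hχ1 n y (T.subset hn hN), ENNReal.ofReal_toReal (lipschitzMinorant_ne_top c n y)]

theorem ofReal_integral_compactlySupported {Y : Type*} [TopologicalSpace Y] [MeasurableSpace Y]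
    [OpensMeasurableSpace Y] (m : Measure Y) [IsFiniteMeasureOnCompacts m] (g : C_c(Y, ℝ))
    (hg : ∀ y, 0 ≤ g y) :
    ENNReal.ofReal (∫ y, g y ∂m) = ∫⁻ y, ENNReal.ofReal (g y) ∂m :=
  ofReal_integral_eq_lintegral_ofReal g.integrable (Eventually.of_forall hg)

/-- The integral of a nonnegative lower semicontinuous function on a proper metric space is a limit
of integrals of compactly supported continuous minorants. -/
theorem exists_seq_compactlySupported_tendsto_lintegral {Y : Type*} [PseudoMetricSpace Y]
    [ProperSpace Y] [MeasurableSpace Y] [OpensMeasurableSpace Y] (m : Measure Y)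
    [IsFiniteMeasureOnCompacts m] {c : Y → ℝ≥0∞} (hc : LowerSemicontinuous c) :
    ∃ g : ℕ → C_c(Y, ℝ), (∀ n y, 0 ≤ g n y) ∧ (∀ n y, ENNReal.ofReal (g n y) ≤ c y) ∧
      Tendsto (fun n => ENNReal.ofReal (∫ y, g n y ∂m)) atTop (𝓝 (∫⁻ y, c y ∂m)) := by
  obtain ⟨g, h0, hle, ht⟩ := exists_seq_compactlySupported_tendsto hc
  refine ⟨g, h0, hle, ?_⟩
  simp_rw [fun n => ofReal_integral_compactlySupported m (g n) (h0 n)]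
  refine tendsto_of_le_liminf_of_limsup_le ?_ ?_
  · calc ∫⁻ y, c y ∂m = ∫⁻ y, liminf (fun n => ENNReal.ofReal (g n y)) atTop ∂m :=
          lintegral_congr fun y => (ht y).liminf_eq.symm
      _ ≤ _ := lintegral_liminf_le fun n => (g n).continuous.measurable.ennreal_ofReal
  · exact limsup_le_of_le (by isBoundedDefault)
      (Eventually.of_forall fun n => lintegral_mono (hle n))

/-- Indicators of open sets are lower semicontinuous, so the comparison passes to open sets, then to
Borel sets by outer regularity of `m'`. -/
theorem Measure.le_of_forall_compactlySupported {Y : Type*} [MetricSpace Y] [ProperSpace Y]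
    [MeasurableSpace Y] [BorelSpace Y] (m m' : Measure Y) [IsFiniteMeasure m] [IsFiniteMeasure m']
    (h : ∀ g : C_c(Y, ℝ), (∀ y, 0 ≤ g y) →
      ENNReal.ofReal (∫ y, g y ∂m) ≤ ∫⁻ y, ENNReal.ofReal (g y) ∂m') : m ≤ m' := by
  have hopen : ∀ U, IsOpen U → m U ≤ m' U := fun U hU => by
    obtain ⟨g, h0, hle, ht⟩ := exists_seq_compactlySupported_tendsto_lintegral m
      (hU.lowerSemicontinuous_indicator (zero_le_one' ℝ≥0∞))
    have e : ∀ m : Measure Y, ∫⁻ y, U.indicator (fun _ => 1) y ∂m = m U := fun m => by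
      rw [lintegral_indicator hU.measurableSet]; simp
    rw [e] at ht
    refine le_of_tendsto' ht fun n => (h (g n) (h0 n)).trans ?_
    rw [← e m']
    exact lintegral_mono (hle n)
  refine Measure.le_iff.2 fun s hs => ?_
  rw [s.measure_eq_iInf_isOpen m']
  exact le_iInf₂ fun U hsU => le_iInf fun hU => (measure_mono hsU).trans (hopen U hU)

/-! ### Compactness provided by the cost -/

namespace IsAdmissibleCost

variable {X : Type*} [MetricSpace X] {c : X → X → ℝ≥0∞}

theorem exists_subseq_tendsto (hc : IsAdmissibleCost c) {x x' : ℕ → X}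
    (hx : Bornology.IsBounded (Set.range x)) {M : ℝ≥0∞} (hM : M ≠ ∞)
    (h : ∀ n, c (x' n) (x n) ≤ M) :
    ∃ p : X × X, ∃ φ : ℕ → ℕ, StrictMono φ ∧
      Tendsto (fun n => (x' (φ n), x (φ n))) atTop (𝓝 p) := by
  have hK := hc.precompact x x' hx ((iSup_le h).trans_lt hM.lt_top)
  obtain ⟨p, -, φ, hφ, hp⟩ := hK.tendsto_subseq
    (x := fun n => (x' n, x n)) fun n => subset_closure ⟨n, rfl⟩
  exact ⟨p, φ, hφ, hp⟩

/-- Since `c x x = 0`, the precompactness assumption applies to `x' = x`, so bounded sequences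
subconverge. -/
theorem properSpace (hc : IsAdmissibleCost c) : ProperSpace X := by
  refine ⟨fun a r => IsSeqCompact.isCompact fun u hu => ?_⟩
  obtain ⟨p, φ, hφ, hp⟩ := hc.exists_subseq_tendsto (x := u) (x' := u)
    (Metric.isBounded_closedBall.subset (Set.range_subset_iff.2 hu)) ENNReal.zero_ne_top
    fun n => (hc.self_eq_zero _).le
  have h2 : Tendsto (u ∘ φ) atTop (𝓝 p.2) := (continuous_snd.tendsto p).comp hp
  exact ⟨p.2, Metric.isClosed_closedBall.mem_of_tendsto h2
    (Eventually.of_forall fun n => hu _), φ, hφ, h2⟩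

theorem isCompact_sublevel (hc : IsAdmissibleCost c) {B : Set X} (hB : IsCompact B) {M : ℝ≥0∞}
    (hM : M ≠ ∞) : IsCompact {p : X × X | p.2 ∈ B ∧ c p.1 p.2 ≤ M} := by
  refine IsSeqCompact.isCompact fun u hu => ?_
  obtain ⟨p, φ, hφ, hp⟩ := hc.exists_subseq_tendsto (x := fun n => (u n).2)
    (x' := fun n => (u n).1) (hB.isBounded.subset (Set.range_subset_iff.2 fun n => (hu n).1)) hM
    fun n => (hu n).2
  refine ⟨p, ?_, φ, hφ, hp⟩
  have hcl : IsClosed {p : X × X | p.2 ∈ B ∧ c p.1 p.2 ≤ M} :=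
    (hB.isClosed.preimage continuous_snd).inter
      (lowerSemicontinuous_iff_isClosed_preimage.1 hc.lsc M)
  exact hcl.mem_of_tendsto hp (Eventually.of_forall fun n => hu _)

end IsAdmissibleCost

/-! ### The c-transform -/

section CTransformOrder

variable {X : Type*} {c : X → X → ℝ≥0∞}

/-- Truncating with `ENNReal.ofReal` keeps the constraint in `ℝ≥0∞`, where `c x' x = ∞` needs no
separate treatment. -/
theorem le_cTransform {f : X → ℝ} {x : X} {a : ℝ}
    (h : ∀ x', ENNReal.ofReal (a - f x') ≤ c x' x) : (a : EReal) ≤ cTransform c f x := by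
  refine le_iInf fun x' => ?_
  have h1 : ((a - f x' : ℝ) : EReal) ≤ (c x' x : EReal) := by
    refine le_trans ?_ (EReal.coe_ennreal_le_coe_ennreal_iff.2 (h x'))
    rw [EReal.coe_ennreal_ofReal]
    exact_mod_cast le_max_left _ _
  calc (a : EReal) = (f x' : EReal) + ((a - f x' : ℝ) : EReal) := by
        rw [← EReal.coe_add]; congr 1; ring
    _ ≤ _ := by gcongr

theorem ofReal_sub_le_of_le_cTransform {f : X → ℝ} {x x' : X} {a : ℝ}
    (h : (a : EReal) ≤ cTransform c f x) : ENNReal.ofReal (a - f x') ≤ c x' x := by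
  have h1 : (a : EReal) ≤ (f x' : EReal) + (c x' x : EReal) := h.trans (iInf_le _ x')
  rcases eq_or_ne (c x' x) ∞ with ht | ht
  · simp [ht]
  · refine ENNReal.ofReal_le_of_le_toReal ?_
    rw [← EReal.coe_ennreal_toReal ht, ← EReal.coe_add, EReal.coe_le_coe_iff] at h1
    linarith

theorem coe_le_cTransform_of_le {f : X → ℝ} {a : ℝ} (h : ∀ x', a ≤ f x') (x : X) :
    (a : EReal) ≤ cTransform c f x :=
  le_cTransform fun x' => by simp [ENNReal.ofReal_of_nonpos (sub_nonpos.2 (h x'))]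

end CTransformOrder

section CTransform

variable {X : Type*} [MetricSpace X] {c : X → X → ℝ≥0∞}

theorem cTransform_le_self (hc : IsAdmissibleCost c) (f : X → ℝ) (x : X) :
    cTransform c f x ≤ (f x : ℝ) :=
  (iInf_le _ x).trans (by simp [hc.self_eq_zero])

variable (f : BoundedContinuousFunction X ℝ)

theorem neg_norm_le_cTransform (x : X) : ((-‖f‖ : ℝ) : EReal) ≤ cTransform c f x :=
  coe_le_cTransform_of_le (fun x' => (abs_le.1 (f.norm_coe_le_norm x')).1) x

theorem cTransform_le_norm (hc : IsAdmissibleCost c) (x : X) :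
    cTransform c f x ≤ (‖f‖ : ℝ) :=
  (cTransform_le_self hc f x).trans
    (EReal.coe_le_coe_iff.2 (abs_le.1 (f.norm_coe_le_norm x)).2)

theorem cTransform_ne_bot (x : X) : cTransform c f x ≠ ⊥ :=
  ((EReal.bot_lt_coe _).trans_le (neg_norm_le_cTransform f x)).ne'

theorem cTransform_ne_top (hc : IsAdmissibleCost c) (x : X) : cTransform c f x ≠ ⊤ :=
  ((cTransform_le_norm f hc x).trans_lt (EReal.coe_lt_top _)).ne

theorem coe_toReal_cTransform (hc : IsAdmissibleCost c) (x : X) :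
    ((cTransform c f x).toReal : EReal) = cTransform c f x :=
  EReal.coe_toReal (cTransform_ne_top f hc x) (cTransform_ne_bot f x)

theorem norm_toReal_cTransform_le (hc : IsAdmissibleCost c) (x : X) :
    ‖(cTransform c f x).toReal‖ ≤ ‖f‖ := by
  refine abs_le.2 ⟨?_, ?_⟩ <;> rw [← EReal.coe_le_coe_iff, coe_toReal_cTransform f hc]
  · exact neg_norm_le_cTransform f x
  · exact cTransform_le_norm f hc x

/-- Near-minimizers `x' n` for convergent data `x n` have bounded cost because `f` is bounded.
Compactness gives a limit point, which competes in the infimum at the limit. -/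
theorem lowerSemicontinuous_cTransform (hc : IsAdmissibleCost c) :
    LowerSemicontinuous (cTransform c f) := by
  refine lowerSemicontinuous_iff_isClosed_preimage.2 fun t => IsSeqClosed.isClosed ?_
  intro x a hx ha
  refine EReal.le_of_forall_lt_iff_le.1 fun b hb => ?_
  have hlt : ∀ n, ∃ x', ((f x' : ℝ) : EReal) + ((c x' (x n) : ℝ≥0∞) : EReal) < b :=
    fun n => iInf_lt_iff.1 (lt_of_le_of_lt (hx n) hb)
  choose x' hx' using hlt
  have hle : ∀ n, c (x' n) (x n) ≤ ENNReal.ofReal (b - f (x' n)) := fun n => by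
    have h1 := hx' n
    rcases eq_or_ne (c (x' n) (x n)) ∞ with ht | ht
    · simp [ht] at h1
    · rw [← EReal.coe_ennreal_toReal ht, ← EReal.coe_add, EReal.coe_lt_coe_iff] at h1
      exact ENNReal.le_ofReal_iff_toReal_le ht
        (by linarith [ENNReal.toReal_nonneg (a := c (x' n) (x n))]) |>.2 (by linarith)
  obtain ⟨p, φ, hφ, hp⟩ := hc.exists_subseq_tendsto (x := x) (x' := x')
    (Metric.isBounded_range_of_tendsto x ha) (M := ENNReal.ofReal (b + ‖f‖)) ENNReal.ofReal_ne_top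
    fun n => (hle n).trans (ENNReal.ofReal_le_ofReal
      (by linarith [(abs_le.1 (f.norm_coe_le_norm (x' n))).1]))
  have hpa : p.2 = a := tendsto_nhds_unique ((continuous_snd.tendsto p).comp hp)
    (ha.comp hφ.tendsto_atTop)
  have h1 : c p.1 p.2 ≤ ENNReal.ofReal (b - f p.1) := by
    have hlim : Tendsto (fun n => ENNReal.ofReal (b - f (x' (φ n)))) atTop
        (𝓝 (ENNReal.ofReal (b - f p.1))) := by
      refine ENNReal.tendsto_ofReal (tendsto_const_nhds.sub ?_)
      exact (f.continuous.tendsto _).comp ((continuous_fst.tendsto p).comp hp)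
    refine le_of_forall_lt fun y hy => ?_
    obtain ⟨z, hyz, hz⟩ := exists_between hy
    refine hyz.trans_le (ge_of_tendsto hlim ?_)
    filter_upwards [hp.eventually (hc.lsc p z hz)] with n hn
    exact hn.le.trans (hle _)
  have hfb : f p.1 ≤ b := by
    have hlim : Tendsto (fun n => f (x' (φ n))) atTop (𝓝 (f p.1)) :=
      (f.continuous.tendsto _).comp ((continuous_fst.tendsto p).comp hp)
    refine le_of_tendsto' hlim fun n => ?_
    rw [← EReal.coe_le_coe_iff]
    exact (le_add_of_nonneg_right (EReal.coe_ennreal_nonneg _)).trans (hx' _).le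
  rw [hpa] at h1
  refine (iInf_le _ p.1).trans ?_
  calc ((f p.1 : ℝ) : EReal) + ((c p.1 a : ℝ≥0∞) : EReal)
      ≤ (f p.1 : ℝ) + ((ENNReal.ofReal (b - f p.1) : ℝ≥0∞) : EReal) := by
        gcongr
        exact EReal.coe_ennreal_le_coe_ennreal_iff.2 h1
    _ = b := by
        rw [EReal.coe_ennreal_ofReal, max_eq_left (sub_nonneg.2 hfb), ← EReal.coe_add]
        congr 1; ring

theorem integrable_toReal_cTransform (hc : IsAdmissibleCost c) [MeasurableSpace X] [BorelSpace X]
    (m : Measure X) [IsFiniteMeasure m] :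
    Integrable (fun x => (cTransform c f x).toReal) m := by
  refine Integrable.of_bound
    ((lowerSemicontinuous_cTransform f hc).measurable.ereal_toReal.aestronglyMeasurable)
    ‖f‖ (Eventually.of_forall fun x => norm_toReal_cTransform_le f hc x)

end CTransform

/-! ### Weak duality -/

theorem ofReal_integral_le_lintegral {Y : Type*} [MeasurableSpace Y] (m : Measure Y)
    {f : Y → ℝ} (hf : Integrable f m) :
    ENNReal.ofReal (∫ y, f y ∂m) ≤ ∫⁻ y, ENNReal.ofReal (f y) ∂m := by
  rw [integral_eq_lintegral_pos_part_sub_lintegral_neg_part hf]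
  exact (ENNReal.ofReal_le_ofReal (sub_le_self _ ENNReal.toReal_nonneg)).trans
    ENNReal.ofReal_toReal_le

theorem ofReal_integral_sub_integral_le_transportCost {X : Type*} [MeasurableSpace X]
    {c : X → X → ℝ≥0∞} {ν m : Measure X} [IsFiniteMeasure ν] {f g : X → ℝ}
    (hf : Integrable f ν) (hg : Integrable g m)
    (h : ∀ x' x, ENNReal.ofReal (g x - f x') ≤ c x' x) :
    ENNReal.ofReal (∫ x, g x ∂m - ∫ x, f x ∂ν) ≤ transportCost c ν m := by
  refine le_iInf₂ fun π hπ => ?_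
  obtain ⟨rfl, rfl⟩ := hπ
  have hf' : Integrable (fun p : X × X => f p.1) π := hf.comp_measurable measurable_fst
  have hg' : Integrable (fun p : X × X => g p.2) π := hg.comp_measurable measurable_snd
  rw [integral_map measurable_snd.aemeasurable hg.1,
    integral_map measurable_fst.aemeasurable hf.1, ← integral_sub hg' hf']
  exact (ofReal_integral_le_lintegral π (hg'.sub hf')).trans
    (lintegral_mono fun p => h p.1 p.2)

/-- The potentials `f i` are only assumed measurable, because the suprema to which this is applied
need not be continuous. -/
theorem ofReal_sum_integral_le_barycenterValue {X : Type*} [MeasurableSpace X] {K : ℕ}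
    {c : X → X → ℝ≥0∞} {μ : Fin K → Measure X} {f g : Fin K → X → ℝ}
    (hfm : ∀ i, Measurable (f i)) (hf0 : ∀ i x, 0 ≤ f i x) (hf1 : ∀ x, ∑ i, f i x ≤ 1)
    (hg : ∀ i, Integrable (g i) (μ i))
    (h : ∀ i x' x, ENNReal.ofReal (g i x - f i x') ≤ c x' x) :
    ENNReal.ofReal (∑ i, ∫ x, g i x ∂(μ i)) ≤ barycenterValue c μ := by
  refine le_iInf fun lam => le_iInf fun ν => le_iInf fun hν => ?_
  have hfle : ∀ i x, f i x ≤ 1 := fun i x =>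
    (Finset.single_le_sum (fun j _ => hf0 j x) (Finset.mem_univ i)).trans (hf1 x)
  have hfi : ∀ i, Integrable (f i) (ν i : Measure X) := fun i =>
    Integrable.of_bound (hfm i).aestronglyMeasurable 1 (Eventually.of_forall fun x => by
      rw [Real.norm_of_nonneg (hf0 i x)]; exact hfle i x)
  have hb : ∑ i, ENNReal.ofReal (∫ x, f i x ∂(ν i : Measure X)) ≤
      (lam : Measure X) Set.univ := by
    calc ∑ i, ENNReal.ofReal (∫ x, f i x ∂(ν i : Measure X))
        = ∑ i, ∫⁻ x, ENNReal.ofReal (f i x) ∂(ν i : Measure X) :=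
          Finset.sum_congr rfl fun i _ =>
            ofReal_integral_eq_lintegral_ofReal (hfi i) (Eventually.of_forall (hf0 i))
      _ ≤ ∑ i, ∫⁻ x, ENNReal.ofReal (f i x) ∂(lam : Measure X) :=
          Finset.sum_le_sum fun i _ => lintegral_mono' (hν i) le_rfl
      _ = ∫⁻ x, ∑ i, ENNReal.ofReal (f i x) ∂(lam : Measure X) :=
          (lintegral_finsetSum _ fun i _ => (hfm i).ennreal_ofReal).symm
      _ ≤ ∫⁻ x, 1 ∂(lam : Measure X) := lintegral_mono fun x => by
          rw [← ENNReal.ofReal_sum_of_nonneg fun i _ => hf0 i x]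
          exact ENNReal.ofReal_le_one.2 (hf1 x)
      _ = _ := by simp
  calc ENNReal.ofReal (∑ i, ∫ x, g i x ∂(μ i))
      ≤ ∑ i, ENNReal.ofReal (∫ x, g i x ∂(μ i)) := 
        Finset.le_sum_of_subadditive _ ENNReal.ofReal_zero.le
          (fun _ _ => ENNReal.ofReal_add_le) _ _
    _ ≤ ∑ i, (ENNReal.ofReal (∫ x, f i x ∂(ν i : Measure X)) +
          transportCost c (ν i : Measure X) (μ i)) := Finset.sum_le_sum fun i _ => by
        refine le_trans ?_ (add_le_add_right
          (ofReal_integral_sub_integral_le_transportCost (hfi i) (hg i) (h i)) _)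
        refine le_trans (ENNReal.ofReal_le_ofReal ?_) ENNReal.ofReal_add_le
        linarith
    _ ≤ _ := by
        rw [Finset.sum_add_distrib]
        gcongr

/-- The supremum is uncountable, but its strict superlevel sets are countable unions of projections
of compact sets, hence Borel. -/
theorem measurable_iSup_sub {X : Type*} [MetricSpace X] [ProperSpace X] [MeasurableSpace X]
    [BorelSpace X] {c : X → X → ℝ≥0∞} (hc : LowerSemicontinuous fun p : X × X => c p.1 p.2)
    {u : X → ℝ≥0∞} (hu : Continuous u) : Measurable fun x' => ⨆ x, (u x - c x' x) := by
  refine measurable_of_Ioi fun t => ?_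
  let T := CompactExhaustion.choice X
  -- Two rationals `q < r` split `t + c < u` into closed conditions on `c` and on `u`.
  let Z : ℕ → ℚ → ℚ → Set (X × X) := fun n q r =>
    (T n ×ˢ T n) ∩ ({p | t + c p.1 p.2 ≤ (Real.toNNReal q : ℝ≥0∞)} ∩
      {p | (Real.toNNReal r : ℝ≥0∞) ≤ u p.2})
  have hZ : ∀ n q r, IsCompact (Z n q r) := fun n q r =>
    ((T.isCompact n).prod (T.isCompact n)).inter_right
      ((lowerSemicontinuous_iff_isClosed_preimage.1 (lowerSemicontinuous_const.add hc) _).inter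
        (isClosed_le continuous_const (hu.comp continuous_snd)))
  have heq : (fun x' => ⨆ x, (u x - c x' x)) ⁻¹' Set.Ioi t =
      ⋃ (n : ℕ) (q : ℚ) (r : ℚ) (_ : Real.toNNReal q < Real.toNNReal r), Prod.fst '' Z n q r := by
    ext x'
    simp only [Set.mem_preimage, Set.mem_Ioi, lt_iSup_iff, lt_tsub_iff_right, Set.mem_iUnion,
      Set.mem_image, exists_prop]
    constructor
    · rintro ⟨x, hx⟩
      obtain ⟨q, -, hq1, hq2⟩ := ENNReal.lt_iff_exists_rat_btwn.1 hx
      obtain ⟨r, -, hr1, hr2⟩ := ENNReal.lt_iff_exists_rat_btwn.1 hq2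
      obtain ⟨n, hn⟩ := T.exists_mem x
      obtain ⟨n', hn'⟩ := T.exists_mem x'
      exact ⟨max n n', q, r, by exact_mod_cast hr1, (x', x),
        ⟨⟨T.subset (le_max_right n n') hn', T.subset (le_max_left n n') hn⟩, hq1.le, hr2.le⟩, rfl⟩
    · rintro ⟨n, q, r, hqr, p, ⟨-, h1, h2⟩, rfl⟩
      exact ⟨p.2, h1.trans_lt ((ENNReal.coe_lt_coe.2 hqr).trans_le h2)⟩
  rw [heq]
  exact .iUnion fun n => .iUnion fun q => .iUnion fun r => .iUnion fun _ =>
    ((hZ n q r).image continuous_fst).isClosed.measurableSet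

theorem ENNReal.sum_iSup_le_of_forall {ι X : Type*} [Fintype ι] [Nonempty X] {h : ι → X → ℝ≥0∞}
    {a : ℝ≥0∞} (H : ∀ x : ι → X, ∑ i, h i (x i) ≤ a) : ∑ i, ⨆ x, h i x ≤ a := by
  choose u hu using fun i => exists_seq_tendsto_sSup (Set.range_nonempty (h i)) (OrderTop.bddAbove _)
  refine le_of_tendsto' (tendsto_finsetSum Finset.univ fun i _ => (hu i).2.1) fun n => ?_
  choose x hx using fun i => (hu i).2.2 n
  simpa only [hx] using H x

theorem IsDecomposedDualFeasible.sum_ofReal_sub_le_one {X : Type*} [TopologicalSpace X] {K : ℕ}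
    {c : X → X → ℝ≥0∞} {g : Fin K → BoundedContinuousFunction X ℝ}
    (hg : IsDecomposedDualFeasible c g) (x' : X) (x : Fin K → X) :
    ∑ i, (ENNReal.ofReal (g i (x i)) - c x' (x i)) ≤ 1 := by
  -- Only indices with a positive term count; for these the cost is finite and can be added back to
  -- both sides.
  let A : Finset (Fin K) := {i | 0 < ENNReal.ofReal (g i (x i)) - c x' (x i)}
  have hpos : ∀ i ∈ A, c x' (x i) < ENNReal.ofReal (g i (x i)) := fun i hi =>
    tsub_pos_iff_lt.1 (Finset.mem_filter.1 hi).2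
  have hsum : ∑ i, (ENNReal.ofReal (g i (x i)) - c x' (x i)) =
      ∑ i ∈ A, (ENNReal.ofReal (g i (x i)) - c x' (x i)) := by
    refine (Finset.sum_subset (Finset.subset_univ A) fun i _ hi => ?_).symm
    simpa [A, tsub_eq_zero_iff_le] using hi
  rw [hsum]
  rcases A.eq_empty_or_nonempty with hA | hA
  · simp [hA]
  have hgpos : ∀ i ∈ A, 0 ≤ g i (x i) := fun i hi =>
    (ENNReal.ofReal_pos.1 (bot_le.trans_lt (hpos i hi))).le
  have hS : ∑ i ∈ A, c x' (x i) ≠ ∞ := ENNReal.sum_ne_top.2 fun i hi => (hpos i hi).ne_top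
  have h1 : ∑ i ∈ A, ENNReal.ofReal (g i (x i)) ≤ 1 + ∑ i ∈ A, c x' (x i) := by
    rw [← ENNReal.ofReal_sum_of_nonneg hgpos, ← EReal.coe_ennreal_le_coe_ennreal_iff,
      EReal.coe_ennreal_ofReal, max_eq_left (Finset.sum_nonneg hgpos)]
    refine (hg A hA x).trans (EReal.coe_ennreal_le_coe_ennreal_iff.2 ?_)
    gcongr
    exact iInf_le _ x'
  refine (ENNReal.add_le_add_iff_right hS).1 (le_trans (le_of_eq ?_) h1)
  rw [← Finset.sum_add_distrib]
  exact Finset.sum_congr rfl fun i hi => tsub_add_cancel_of_le (hpos i hi).le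

theorem decomposedDualValue_le_barycenterValue {X : Type*} [MetricSpace X] [ProperSpace X]
    [MeasurableSpace X] [BorelSpace X] {K : ℕ} {c : X → X → ℝ≥0∞}
    (hc : LowerSemicontinuous fun p : X × X => c p.1 p.2)
    (μ : Fin K → Measure X) [∀ i, IsFiniteMeasure (μ i)] :
    decomposedDualValue c μ ≤ ((barycenterValue c μ : ℝ≥0∞) : EReal) := by
  refine iSup₂_le fun g hg => ?_
  -- The smallest nonnegative potentials with `g i x - F i x' ≤ c x' x`.
  let F : Fin K → X → ℝ≥0∞ := fun i x' => ⨆ x, (ENNReal.ofReal (g i x) - c x' x)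
  have hFsum : ∀ x', ∑ i, F i x' ≤ 1 := fun x' =>
    haveI : Nonempty X := ⟨x'⟩
    ENNReal.sum_iSup_le_of_forall fun x => hg.sum_ofReal_sub_le_one x' x
  have hFtop : ∀ i x', F i x' ≠ ∞ := fun i x' => ne_top_of_le_ne_top ENNReal.one_ne_top
    ((Finset.single_le_sum (fun _ _ => zero_le) (Finset.mem_univ i)).trans (hFsum x'))
  have key := ofReal_sum_integral_le_barycenterValue (μ := μ) (c := c)
    (f := fun i x' => (F i x').toReal) (g := fun i => g i)
    (fun i => (measurable_iSup_sub hc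
      (ENNReal.continuous_ofReal.comp (g i).continuous)).ennreal_toReal)
    (fun i x => ENNReal.toReal_nonneg) (fun x => ?_) (fun i => (g i).integrable _) ?_
  · refine le_trans ?_ (EReal.coe_ennreal_le_coe_ennreal_iff.2 key)
    rw [EReal.coe_ennreal_ofReal]
    exact_mod_cast le_max_left _ _
  · rw [← ENNReal.toReal_sum fun i _ => hFtop i x]
    exact ENNReal.toReal_le_of_le_ofReal zero_le_one (by simpa using hFsum x)
  · intro i x' x
    rw [ENNReal.ofReal_sub _ ENNReal.toReal_nonneg, ENNReal.ofReal_toReal (hFtop i x'),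
      tsub_le_iff_left, ← tsub_le_iff_right]
    exact le_iSup (fun x => ENNReal.ofReal (g i x) - c x' x) x

/-! ### Comparison of the three dual problems -/

/-- The indicator `r` of `A`, with all weight on `A`, recovers the constraint for `A`. Conversely,
the constraints for all `A`, weighted by `m A`, add up to the full one. -/
theorem isFullDualFeasible_iff {X : Type*} [TopologicalSpace X] {K : ℕ} {c : X → X → ℝ≥0∞}
    {g : Fin K → BoundedContinuousFunction X ℝ} :
    IsFullDualFeasible c g ↔ IsDecomposedDualFeasible c g := by
  classical
  constructor
  · intro hg A hA x
    have h := hg x fun i => if i ∈ A then 1 else 0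
    have e : ∑ i, (((if i ∈ A then 1 else 0 : unitInterval) : ℝ)) * g i (x i) =
        ∑ i ∈ A, g i (x i) := by
      rw [← Finset.sum_subset (Finset.subset_univ A)]
      · exact Finset.sum_congr rfl fun i hi => by simp [hi]
      · intro i _ hi; simp [hi]
    rw [e] at h
    refine h.trans (EReal.coe_ennreal_le_coe_ennreal_iff.2 ?_)
    refine (iInf₂_le (Pi.single ⟨A, hA⟩ 1) fun i => ?_).trans (le_of_eq ?_)
    · rw [Finset.sum_filter, Finset.sum_eq_single ⟨A, hA⟩]
      · by_cases hi : i ∈ A <;> simp [hi]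
      · intro B _ hB; simp [hB]
      · simp
    · rw [Finset.sum_eq_single ⟨A, hA⟩]
      · simp [add_comm]
      · intro B _ hB; simp [hB]
      · simp
  · intro hg x r
    refine le_trans ?_ (EReal.coe_ennreal_le_coe_ennreal_iff.2
      (le_iInf₂ (a := ENNReal.ofReal (∑ i, (r i : ℝ) * g i (x i))) fun m hm => ?_))
    · rw [EReal.coe_ennreal_ofReal]
      exact_mod_cast le_max_left _ _
    have e : ∑ i, (r i : ℝ) * g i (x i) =
        ∑ A : NonemptySubsets K, (m A : ℝ) * ∑ i ∈ A.1, g i (x i) := by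
      simp_rw [← hm, Finset.sum_mul, Finset.mul_sum, Finset.sum_filter]
      rw [Finset.sum_comm]
      refine Finset.sum_congr rfl fun A _ => ?_
      rw [← Finset.sum_filter]
      simp
    rw [e]
    refine (Finset.le_sum_of_subadditive _ ENNReal.ofReal_zero.le
      (fun _ _ => ENNReal.ofReal_add_le) _ _).trans (Finset.sum_le_sum fun A _ => ?_)
    rw [ENNReal.ofReal_mul NNReal.zero_le_coe, ENNReal.ofReal_coe_nnreal]
    gcongr
    rw [← EReal.coe_ennreal_le_coe_ennreal_iff, EReal.coe_ennreal_ofReal, add_comm (groupCost _ _ _)]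
    rcases max_choice (∑ i ∈ A.1, g i (x i)) 0 with h | h <;> rw [h]
    · exact hg A.1 A.2 x
    · exact EReal.coe_ennreal_nonneg _

theorem fullDualValue_eq_decomposedDualValue {X : Type*} [TopologicalSpace X] [MeasurableSpace X]
    {K : ℕ} (c : X → X → ℝ≥0∞) (μ : Fin K → Measure X) :
    fullDualValue c μ = decomposedDualValue c μ := by
  simp only [fullDualValue, decomposedDualValue, isFullDualFeasible_iff]

/-- All indices in `A` are tested at a common `x'`; nonnegativity of `f` bounds the partial sum over
`A` by 1. Minorants `g` are allowed since `f^c` may fail to be continuous. -/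
theorem IsBarycenterDualFeasible.isDecomposedDualFeasible {X : Type*} [TopologicalSpace X] {K : ℕ}
    {c : X → X → ℝ≥0∞} {f g : Fin K → BoundedContinuousFunction X ℝ}
    (hf : IsBarycenterDualFeasible f) (h : ∀ i x, (g i x : EReal) ≤ cTransform c (f i) x) :
    IsDecomposedDualFeasible c g := by
  intro A _ x
  have hle : ENNReal.ofReal (∑ i ∈ A, g i (x i) - 1) ≤ groupCost c A x := le_iInf fun x' => by
    have h1 : ∑ i ∈ A, f i x' ≤ 1 :=
      (Finset.sum_le_sum_of_subset_of_nonneg (Finset.subset_univ A)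
        fun i _ _ => hf.1 i x').trans (hf.2 x')
    calc ENNReal.ofReal (∑ i ∈ A, g i (x i) - 1)
        ≤ ENNReal.ofReal (∑ i ∈ A, (g i (x i) - f i x')) :=
          ENNReal.ofReal_le_ofReal (by rw [Finset.sum_sub_distrib]; linarith)
      _ ≤ ∑ i ∈ A, ENNReal.ofReal (g i (x i) - f i x') :=
          Finset.le_sum_of_subadditive _ ENNReal.ofReal_zero.le
            (fun _ _ => ENNReal.ofReal_add_le) _ _
      _ ≤ ∑ i ∈ A, c x' (x i) :=
          Finset.sum_le_sum fun i _ => ofReal_sub_le_of_le_cTransform (h i (x i))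
  refine le_trans ?_ (EReal.coe_ennreal_le_coe_ennreal_iff.2 (add_le_add_right hle 1))
  rw [EReal.coe_ennreal_add, EReal.coe_ennreal_ofReal, EReal.coe_ennreal_one]
  norm_cast
  linarith [le_max_left (∑ i ∈ A, g i (x i) - 1) 0]

theorem barycenterDualValue_le_decomposedDualValue {X : Type*} [MetricSpace X]
    [MeasurableSpace X] [BorelSpace X] {K : ℕ} {c : X → X → ℝ≥0∞} (hc : IsAdmissibleCost c)
    (μ : Fin K → Measure X) [∀ i, IsFiniteMeasure (μ i)] :
    barycenterDualValue c μ ≤ decomposedDualValue c μ := by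
  have := hc.properSpace
  refine iSup₂_le fun f hf => ?_
  have h0 : ∀ i x, 0 ≤ (cTransform c (f i) x).toReal := fun i x =>
    EReal.toReal_nonneg (by simpa using coe_le_cTransform_of_le (c := c) (hf.1 i) x)
  have hlsc : ∀ i, LowerSemicontinuous fun x => (cTransform c (f i) x).toENNReal := fun i =>
    EReal.continuous_toENNReal.comp_lowerSemicontinuous (lowerSemicontinuous_cTransform (f i) hc)
      fun _ _ h => EReal.toENNReal_le_toENNReal h
  choose g hg0 hgle hgt using fun i => exists_seq_compactlySupported_tendsto_lintegral (μ i) (hlsc i)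
  have hcoe : ∀ i x, (cTransform c (f i) x).toENNReal =
      ENNReal.ofReal (cTransform c (f i) x).toReal := fun i x =>
    EReal.toENNReal_of_ne_top (cTransform_ne_top (f i) hc x)
  have hlim : ∀ i, Tendsto (fun n => ∫ x, g i n x ∂(μ i)) atTop
      (𝓝 (∫ x, (cTransform c (f i) x).toReal ∂(μ i))) := fun i => by
    have h1 := hgt i
    simp_rw [hcoe] at h1
    rw [← ofReal_integral_eq_lintegral_ofReal (integrable_toReal_cTransform (f i) hc (μ i))
      (Eventually.of_forall (h0 i))] at h1
    have h2 := (ENNReal.tendsto_toReal ENNReal.ofReal_ne_top).comp h1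
    rw [ENNReal.toReal_ofReal (integral_nonneg (h0 i))] at h2
    exact h2.congr fun n => ENNReal.toReal_ofReal (integral_nonneg (hg0 i n))
  have hsum := (continuous_coe_real_ereal.tendsto _).comp
    (tendsto_finsetSum Finset.univ fun i _ => hlim i)
  refine le_of_tendsto' hsum fun n => ?_
  refine le_iSup₂_of_le (fun i => (g i n).toBoundedContinuousFunction)
    (hf.isDecomposedDualFeasible fun i x => ?_) le_rfl
  rw [← coe_toReal_cTransform (f i) hc x]
  have h1 := hgle i n x
  rw [hcoe] at h1
  exact EReal.coe_le_coe_iff.2 ((ENNReal.ofReal_le_ofReal_iff (h0 i x)).1 h1)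

/-! ### Riesz extension and representation -/

/-- The linear constraints of the dual problem, relaxed by compactly supported perturbations
`u`, `w` of the constraints and homogenized by `s`. -/
structure IsSubordinate {X : Type*} [TopologicalSpace X] {K : ℕ} (c : X → X → ℝ≥0∞) (s : ℝ)
    (φ f : Fin K → BoundedContinuousFunction X ℝ) (u : C_c(X, ℝ)) (w : Fin K → C_c(X × X, ℝ)) :
    Prop where
  nonneg : 0 ≤ s
  nonneg_left : ∀ i x, 0 ≤ f i x
  add_sum_le : ∀ x, u x + ∑ i, f i x ≤ s
  ofReal_le : ∀ i x' x, ENNReal.ofReal (w i (x', x) + φ i x - f i x') ≤ ENNReal.ofReal s * c x' x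

section Extension

variable {X : Type*} [TopologicalSpace X] {K : ℕ}

variable (X K) in
/-- The space of homogenized dual variables and perturbations. -/
abbrev PerturbationSpace : Type _ :=
  ℝ × (Fin K → BoundedContinuousFunction X ℝ) × C_c(X, ℝ) × (Fin K → C_c(X × X, ℝ))

/-- The cone of subordinate tuples. -/
def subordinateCone (c : X → X → ℝ≥0∞) : PointedCone ℝ (PerturbationSpace X K) where
  carrier := {e | ∃ f, IsSubordinate c e.1 e.2.1 f e.2.2.1 e.2.2.2}
  zero_mem' := ⟨0, by constructor <;> simp⟩
  add_mem' := by
    rintro ⟨s, φ, u, w⟩ ⟨s', φ', u', w'⟩ ⟨f, hf⟩ ⟨f', hf'⟩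
    refine ⟨f + f', add_nonneg hf.1 hf'.1, fun i x => add_nonneg (hf.2 i x) (hf'.2 i x),
      fun x => ?_, fun i x' x => ?_⟩
    · have h := add_le_add (hf.3 x) (hf'.3 x)
      simp only [Prod.mk_add_mk, CompactlySupportedContinuousMap.add_apply, Pi.add_apply,
        BoundedContinuousFunction.add_apply, Finset.sum_add_distrib] at h ⊢
      linarith
    · simp only [Prod.mk_add_mk, CompactlySupportedContinuousMap.add_apply, Pi.add_apply,
        BoundedContinuousFunction.add_apply]
      rw [ENNReal.ofReal_add hf.1 hf'.1, add_mul]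
      refine le_trans ?_ (add_le_add (hf.4 i x' x) (hf'.4 i x' x))
      refine le_trans (ENNReal.ofReal_le_ofReal (le_of_eq ?_)) ENNReal.ofReal_add_le
      ring
  smul_mem' := by
    rintro ⟨a, ha⟩ ⟨s, φ, u, w⟩ ⟨f, hf⟩
    refine ⟨a • f, mul_nonneg ha hf.1, fun i x => mul_nonneg ha (hf.2 i x),
      fun x => ?_, fun i x' x => ?_⟩
    · have h := mul_le_mul_of_nonneg_left (hf.3 x) ha
      rw [mul_add, Finset.mul_sum] at h
      exact h
    · have h : ENNReal.ofReal (a * (w i (x', x) + φ i x - f i x')) ≤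
          ENNReal.ofReal (a * s) * c x' x := by
        rw [ENNReal.ofReal_mul ha, ENNReal.ofReal_mul ha, mul_assoc]
        gcongr
        exact hf.4 i x' x
      rw [mul_sub, mul_add] at h
      exact h

variable [MeasurableSpace X] [BorelSpace X]

/-- The homogenized dual gap functional. -/
def dualGap (μ : Fin K → Measure X) [∀ i, IsFiniteMeasure (μ i)] (D : ℝ) :
    PerturbationSpace X K →ₗ[ℝ] ℝ where
  toFun e := e.1 * D - ∑ i, ∫ x, e.2.1 i x ∂(μ i)
  map_add' e e' := by
    have h : ∀ i, ∫ x, (e.2.1 i x + e'.2.1 i x) ∂(μ i) =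
        ∫ x, e.2.1 i x ∂(μ i) + ∫ x, e'.2.1 i x ∂(μ i) := fun i =>
      integral_add ((e.2.1 i).integrable _) ((e'.2.1 i).integrable _)
    simp only [Prod.fst_add, Prod.snd_add, Pi.add_apply, BoundedContinuousFunction.add_apply, h,
      Finset.sum_add_distrib]
    ring
  map_smul' a e := by
    simp only [Prod.smul_fst, Prod.smul_snd, Pi.smul_apply, BoundedContinuousFunction.smul_apply,
      smul_eq_mul, integral_const_mul, ← Finset.mul_sum, RingHom.id_apply]
    ring

/-- Perturbed duality inequality: if `D` bounds the dual problem, a functional on the perturbations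
is dominated by the gap, by the Riesz extension theorem. -/
theorem exists_extension_dualGap (c : X → X → ℝ≥0∞)
    (μ : Fin K → Measure X) [∀ i, IsFiniteMeasure (μ i)] (D : ℝ)
    (hD : ∀ s φ f, IsSubordinate c s φ f 0 0 → ∑ i, ∫ x, φ i x ∂(μ i) ≤ s * D) :
    ∃ G : PerturbationSpace X K →ₗ[ℝ] ℝ,
      (∀ s φ, G (s, φ, 0, 0) = s * D - ∑ i, ∫ x, φ i x ∂(μ i)) ∧
      ∀ e ∈ subordinateCone c, 0 ≤ G e := by
  let p : Submodule ℝ (PerturbationSpace X K) :=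
    LinearMap.ker ((LinearMap.snd ℝ _ _).comp (LinearMap.snd ℝ _ _))
  have hp : ∀ s φ, ((s, φ, 0, 0) : PerturbationSpace X K) ∈ p := fun s φ =>
    LinearMap.mem_ker.2 rfl
  have hnonneg : ∀ e : p, (e : PerturbationSpace X K) ∈ subordinateCone c →
      0 ≤ (dualGap μ D).domRestrict p e := by
    rintro ⟨⟨s, φ, uw⟩, he⟩ ⟨f, hf⟩
    obtain rfl : uw = 0 := LinearMap.mem_ker.1 he
    exact sub_nonneg.2 (hD s φ f hf)
  have hdense : ∀ e : PerturbationSpace X K, ∃ e' : p, (e' : PerturbationSpace X K) + e ∈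
      subordinateCone c := by
    rintro ⟨s, φ, u, w⟩
    -- After translation the tuple is `(‖u‖, -‖w i‖, u, w)`, subordinate with `f = 0`. This needs
    -- constants among the `φ i`, hence bounded rather than compactly supported functions.
    refine ⟨⟨(‖u.toBoundedContinuousFunction‖ - s,
      fun i => -φ i - BoundedContinuousFunction.const X ‖(w i).toBoundedContinuousFunction‖,
      0, 0), hp _ _⟩, 0, ?_, fun i x => le_rfl, fun x => ?_, fun i x' x => ?_⟩
    · simp
    · have h := (abs_le.1 (u.toBoundedContinuousFunction.norm_coe_le_norm x)).2
      simpa using h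
    · have h := (abs_le.1 ((w i).toBoundedContinuousFunction.norm_coe_le_norm (x', x))).2
      rw [ENNReal.ofReal_of_nonpos]
      · exact zero_le
      · simp at h ⊢
        linarith
  obtain ⟨G, hG, hpos⟩ := riesz_extension (subordinateCone c)
    ⟨p, (dualGap μ D).domRestrict p⟩ hnonneg hdense
  exact ⟨G, fun s φ => hG ⟨_, hp s φ⟩, hpos⟩

/-- Riesz representation of the functional given by the extension theorem. -/
theorem exists_measures_of_dual_bound [T2Space X] [LocallyCompactSpace X]
    [SecondCountableTopology X] (c : X → X → ℝ≥0∞)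
    (μ : Fin K → Measure X) [∀ i, IsFiniteMeasure (μ i)] (D : ℝ)
    (hD : ∀ s φ f, IsSubordinate c s φ f 0 0 → ∑ i, ∫ x, φ i x ∂(μ i) ≤ s * D) :
    ∃ (lam : Measure X) (π : Fin K → Measure (X × X)), IsFiniteMeasureOnCompacts lam ∧
      (∀ i, IsFiniteMeasureOnCompacts (π i)) ∧
      ∀ s φ f u w, IsSubordinate c s φ f u w →
        ∫ x, u x ∂lam + ∑ i, ∫ p, w i p ∂(π i) + ∑ i, ∫ x, φ i x ∂(μ i) ≤ s * D := by
  obtain ⟨G, hG, hpos⟩ := exists_extension_dualGap c μ D hD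
  -- Lowering `u` or `w` preserves subordination, so `G` is nonpositive on nonnegative
  -- perturbations; hence the sign.
  let L : C_c(X, ℝ) →ₗ[ℝ] ℝ := -(G ∘ₗ LinearMap.inr ℝ _ _ ∘ₗ LinearMap.inr ℝ _ _ ∘ₗ
    LinearMap.inl ℝ _ _)
  let W : Fin K → C_c(X × X, ℝ) →ₗ[ℝ] ℝ := fun i => -(G ∘ₗ LinearMap.inr ℝ _ _ ∘ₗ
    LinearMap.inr ℝ _ _ ∘ₗ LinearMap.inr ℝ _ _ ∘ₗ LinearMap.single ℝ _ i)
  have hL : ∀ u, 0 ≤ u → 0 ≤ L u := fun u hu => by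
    have h := hpos (0, 0, -u, 0) ⟨0, le_rfl, fun i x => le_rfl, fun x => ?_, fun i x' x => ?_⟩
    · have e : ((0, 0, -u, 0) : PerturbationSpace X K) = -(0, 0, u, 0) := by simp
      rw [e, map_neg] at h
      exact h
    · simpa using hu x
    · simp
  have hW : ∀ i w, 0 ≤ w → 0 ≤ W i w := fun i w hw => by
    have h := hpos (0, 0, 0, -Pi.single i w)
      ⟨0, le_rfl, fun i x => le_rfl, fun x => ?_, fun j x' x => ?_⟩
    · have e : ((0, 0, 0, -Pi.single i w) : PerturbationSpace X K) =
          -(0, 0, 0, Pi.single i w) := by simp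
      rw [e, map_neg] at h
      exact h
    · simp
    · rw [ENNReal.ofReal_of_nonpos]
      · exact zero_le
      · rcases eq_or_ne j i with rfl | hj
        · simpa using hw (x', x)
        · simp [hj]
  let L' : C_c(X, ℝ) →ₚ[ℝ] ℝ := PositiveLinearMap.mk₀ L hL
  let W' : Fin K → C_c(X × X, ℝ) →ₚ[ℝ] ℝ := fun i => PositiveLinearMap.mk₀ (W i) (hW i)
  refine ⟨RealRMK.rieszMeasure L', fun i => RealRMK.rieszMeasure (W' i), inferInstance,
    fun i => inferInstance, fun s φ f u w h => ?_⟩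
  simp_rw [RealRMK.integral_rieszMeasure]
  have h0 := hpos (s, φ, u, w) ⟨f, h⟩
  have e : ((s, φ, u, w) : PerturbationSpace X K) =
      (s, φ, 0, 0) + (0, 0, u, 0) + ∑ i, (0, 0, 0, Pi.single i (w i)) := by
    have : ∑ i, ((0, 0, 0, Pi.single i (w i)) : PerturbationSpace X K) = (0, 0, 0, w) := by
      simp [Prod.ext_iff, Prod.fst_sum, Prod.snd_sum, Finset.univ_sum_single]
    simp [this]
  rw [e, map_add, map_add, map_sum, hG] at h0
  have h1 : L' u = -G (0, 0, u, 0) := rfl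
  have h2 : ∀ i, W' i (w i) = -G (0, 0, 0, Pi.single i (w i)) := fun i => rfl
  simp_rw [h1, h2, Finset.sum_neg_distrib]
  linarith

end Extension

theorem lintegral_le_ofReal_of_forall_compactlySupported {Y : Type*} [PseudoMetricSpace Y]
    [ProperSpace Y] [MeasurableSpace Y] [OpensMeasurableSpace Y] (m : Measure Y)
    [IsFiniteMeasureOnCompacts m] {c : Y → ℝ≥0∞} (hc : LowerSemicontinuous c) {a : ℝ}
    (h : ∀ g : C_c(Y, ℝ), (∀ y, ENNReal.ofReal (g y) ≤ c y) → ∫ y, g y ∂m ≤ a) :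
    ∫⁻ y, c y ∂m ≤ ENNReal.ofReal a := by
  obtain ⟨g, -, hle, ht⟩ := exists_seq_compactlySupported_tendsto_lintegral m hc
  exact le_of_tendsto' ht fun n => ENNReal.ofReal_le_ofReal (h (g n) (hle n))

theorem IsSubordinate.single {X : Type*} [TopologicalSpace X] {K : ℕ} {c : X → X → ℝ≥0∞}
    (i : Fin K) {s : ℝ} {φ f : BoundedContinuousFunction X ℝ} {u : C_c(X, ℝ)} {w : C_c(X × X, ℝ)}
    (hs : 0 ≤ s) (hf : ∀ x, 0 ≤ f x) (hu : ∀ x, u x + f x ≤ s)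
    (hw : ∀ x' x, ENNReal.ofReal (w (x', x) + φ x - f x') ≤ ENNReal.ofReal s * c x' x) :
    IsSubordinate c s (Pi.single i φ) (Pi.single i f) u (Pi.single i w) where
  nonneg := hs
  nonneg_left j x := by
    rcases eq_or_ne j i with rfl | hj
    · simpa using hf x
    · simp [hj]
  add_sum_le x := by
    rw [Finset.sum_eq_single i]
    · simpa using hu x
    · intro j _ hj; simp [hj]
    · simp
  ofReal_le j x' x := by
    rcases eq_or_ne j i with rfl | hj
    · simpa using hw x' x
    · simp [hj]

/-! ### The representing measures as a primal competitor -/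

section StrongDuality

variable {X : Type*} [MetricSpace X] [MeasurableSpace X] {K : ℕ}
  {c : X → X → ℝ≥0∞} {μ : Fin K → Measure X} {D : ℝ} {lam : Measure X}
  {π : Fin K → Measure (X × X)}

/-- The pair `(lam, π)` satisfies the perturbed duality inequality with bound `D`. -/
def SatisfiesDualityInequality (c : X → X → ℝ≥0∞) (μ : Fin K → Measure X) (D : ℝ)
    (lam : Measure X) (π : Fin K → Measure (X × X)) : Prop :=
  ∀ s φ f u w, IsSubordinate c s φ f u w →
    ∫ x, u x ∂lam + ∑ i, ∫ p, w i p ∂(π i) + ∑ i, ∫ x, φ i x ∂(μ i) ≤ s * D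

namespace SatisfiesDualityInequality

theorem single (H : SatisfiesDualityInequality c μ D lam π) (i : Fin K) {s : ℝ}
    {φ f : BoundedContinuousFunction X ℝ} {u : C_c(X, ℝ)} {w : C_c(X × X, ℝ)}
    (hs : 0 ≤ s) (hf : ∀ x, 0 ≤ f x) (hu : ∀ x, u x + f x ≤ s)
    (hw : ∀ x' x, ENNReal.ofReal (w (x', x) + φ x - f x') ≤ ENNReal.ofReal s * c x' x) :
    ∫ x, u x ∂lam + ∫ p, w p ∂(π i) + ∫ x, φ x ∂(μ i) ≤ s * D := by
  have h := H _ _ _ _ _ (IsSubordinate.single i hs hf hu hw)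
  rw [Finset.sum_eq_single i, Finset.sum_eq_single i, Pi.single_eq_same, Pi.single_eq_same] at h
  · exact h
  · intro j _ hj; simp [hj]
  · simp
  · intro j _ hj; simp [hj]
  · simp

variable [BorelSpace X]

/-- At `s = 0` the cost disappears from the constraint, even where it is infinite, as `0 * ∞ = 0`.
What remains is a pure marginal inequality. -/
theorem lintegral_snd_le (H : SatisfiesDualityInequality c μ D lam π) [ProperSpace X]
    [∀ i, IsFiniteMeasureOnCompacts (π i)] (i : Fin K) (ψ : BoundedContinuousFunction X ℝ)
    (hψ : ∀ x, 0 ≤ ψ x) :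
    ∫⁻ p, ENNReal.ofReal (ψ p.2) ∂(π i) ≤ ENNReal.ofReal (∫ x, ψ x ∂(μ i)) := by
  refine lintegral_le_ofReal_of_forall_compactlySupported (π i)
    (ENNReal.continuous_ofReal.comp (ψ.continuous.comp continuous_snd)).lowerSemicontinuous
    fun g hg => ?_
  have h := H.single i (s := 0) (φ := -ψ) (f := 0) (u := 0) (w := g) le_rfl (fun x => le_rfl)
    (fun x => by simp) fun x' x => by
      have h1 := (ENNReal.ofReal_le_ofReal_iff (hψ x)).1 (hg (x', x))
      simpa using h1
  simp only [CompactlySupportedContinuousMap.zero_apply, integral_zero,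
    BoundedContinuousFunction.neg_apply, integral_neg] at h
  linarith

theorem isFiniteMeasure (H : SatisfiesDualityInequality c μ D lam π) [ProperSpace X]
    [∀ i, IsFiniteMeasureOnCompacts (π i)] (i : Fin K) : IsFiniteMeasure (π i) :=
  ⟨by
    have h := H.lintegral_snd_le i 1 fun x => zero_le_one
    simp only [BoundedContinuousFunction.coe_one, Pi.one_apply, ENNReal.ofReal_one,
      lintegral_one] at h
    exact h.trans_lt ENNReal.ofReal_lt_top⟩

theorem lintegral_fst_le (H : SatisfiesDualityInequality c μ D lam π) [ProperSpace X]
    [∀ i, IsFiniteMeasureOnCompacts (π i)] (i : Fin K) (ψ : C_c(X, ℝ)) (hψ : ∀ x, 0 ≤ ψ x) :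
    ∫⁻ p, ENNReal.ofReal (ψ p.1) ∂(π i) ≤ ENNReal.ofReal (∫ x, ψ x ∂lam) := by
  refine lintegral_le_ofReal_of_forall_compactlySupported (π i)
    (ENNReal.continuous_ofReal.comp (ψ.continuous.comp continuous_fst)).lowerSemicontinuous
    fun g hg => ?_
  have h := H.single i (s := 0) (φ := 0) (f := ψ.toBoundedContinuousFunction) (u := -ψ) (w := g)
    le_rfl hψ (fun x => by simp) fun x' x => by
      have h1 := (ENNReal.ofReal_le_ofReal_iff (hψ x')).1 (hg (x', x))
      simpa using h1
  simp only [CompactlySupportedContinuousMap.neg_apply, integral_neg,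
    BoundedContinuousFunction.coe_zero, Pi.zero_apply, integral_zero] at h
  linarith

/-- The function `ψ p.2` is not compactly supported on the product and is cut off by `χ`. Where `χ`
is not 1 on the support of `ψ`, the cost exceeds `M / s`, so `s * c` pays for `ψ`; the price is an
error `s * D`. -/
theorem integral_le_lintegral_snd (H : SatisfiesDualityInequality c μ D lam π)
    (hc : IsAdmissibleCost c) [∀ i, IsFiniteMeasureOnCompacts (π i)] (i : Fin K)
    (ψ : C_c(X, ℝ)) (hψ : ∀ x, 0 ≤ ψ x) :
    ENNReal.ofReal (∫ x, ψ x ∂(μ i)) ≤ ∫⁻ p, ENNReal.ofReal (ψ p.2) ∂(π i) := by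
  have := hc.properSpace
  refine ENNReal.le_of_forall_pos_le_add fun ε hε _ => ?_
  -- Chosen so that `s * D ≤ ε`; the `+ 1` covers `D = 0`.
  let s : ℝ := ε / (|D| + 1)
  have hs : 0 < s := by positivity
  have hsD : s * D ≤ ε := by
    calc s * D ≤ s * (|D| + 1) := by gcongr; linarith [le_abs_self D]
      _ = ε := div_mul_cancel₀ _ (by positivity)
  let M : ℝ := ‖ψ.toBoundedContinuousFunction‖
  have hM : ∀ x, ψ x ≤ M := fun x =>
    (abs_le.1 (ψ.toBoundedContinuousFunction.norm_coe_le_norm x)).2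
  have hs0 : ENNReal.ofReal s ≠ 0 := (ENNReal.ofReal_pos.2 hs).ne'
  obtain ⟨χ, hχ1, hχ0, hχle⟩ := exists_compactlySupported_eq_one
    (hc.isCompact_sublevel ψ.hasCompactSupport (M := ENNReal.ofReal M / ENNReal.ofReal s)
      (ENNReal.div_ne_top ENNReal.ofReal_ne_top hs0))
  let w : C_c(X × X, ℝ) := cutoff χ ⟨fun p => ψ p.2, ψ.continuous.comp continuous_snd⟩
  have hw : ∀ p, w p = ψ p.2 * χ p := fun p => rfl
  have hw0 : ∀ p, 0 ≤ w p := fun p => mul_nonneg (hψ _) (hχ0 _)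
  have h := H.single i (s := s) (φ := ψ.toBoundedContinuousFunction) (f := 0) (u := 0) (w := -w)
    hs.le (fun x => le_rfl) (fun x => by simpa using hs.le) fun x' x => by
      have e : (-w) (x', x) + ψ.toBoundedContinuousFunction x -
          (0 : BoundedContinuousFunction X ℝ) x' = ψ x * (1 - χ (x', x)) := by
        simp [hw]; ring
      rw [e]
      by_cases hx : x ∈ tsupport ψ
      · by_cases hcx : c x' x ≤ ENNReal.ofReal M / ENNReal.ofReal s
        · simp [hχ1 (x', x) ⟨hx, hcx⟩]
        · calc ENNReal.ofReal (ψ x * (1 - χ (x', x))) ≤ ENNReal.ofReal M :=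
                ENNReal.ofReal_le_ofReal ((mul_le_of_le_one_right (hψ x)
                  (by linarith [hχ0 (x', x)])).trans (hM x))
            _ = ENNReal.ofReal s * (ENNReal.ofReal M / ENNReal.ofReal s) :=
                (ENNReal.mul_div_cancel hs0 ENNReal.ofReal_ne_top).symm
            _ ≤ _ := by gcongr; exact (not_le.1 hcx).le
      · simp [image_eq_zero_of_notMem_tsupport hx]
  simp only [CompactlySupportedContinuousMap.zero_apply, integral_zero,
    CompactlySupportedContinuousMap.neg_apply, integral_neg,
    CompactlySupportedContinuousMap.toBoundedContinuousFunction_apply] at h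
  calc ENNReal.ofReal (∫ x, ψ x ∂(μ i)) ≤ ENNReal.ofReal (∫ p, w p ∂(π i) + ε) :=
        ENNReal.ofReal_le_ofReal (by linarith)
    _ ≤ ENNReal.ofReal (∫ p, w p ∂(π i)) + ENNReal.ofReal ε := ENNReal.ofReal_add_le
    _ ≤ _ := by
        rw [ofReal_integral_compactlySupported _ w hw0, ENNReal.ofReal_coe_nnreal]
        gcongr with p
        exact mul_le_of_le_one_right (hψ _) (hχle _)

theorem map_snd_eq (H : SatisfiesDualityInequality c μ D lam π) (hc : IsAdmissibleCost c)
    [∀ i, IsFiniteMeasure (μ i)] [∀ i, IsFiniteMeasureOnCompacts (π i)] (i : Fin K) :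
    (π i).map Prod.snd = μ i := by
  have := hc.properSpace
  have := H.isFiniteMeasure i
  have e : ∀ g : C_c(X, ℝ), ∫⁻ x, ENNReal.ofReal (g x) ∂((π i).map Prod.snd) =
      ∫⁻ p, ENNReal.ofReal (g p.2) ∂(π i) := fun g =>
    lintegral_map g.continuous.measurable.ennreal_ofReal measurable_snd
  refine le_antisymm (Measure.le_of_forall_compactlySupported _ _ fun g hg => ?_)
    (Measure.le_of_forall_compactlySupported _ _ fun g hg => ?_)
  · rw [ofReal_integral_compactlySupported _ g hg, e,
      ← ofReal_integral_compactlySupported _ g hg]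
    exact H.lintegral_snd_le i g.toBoundedContinuousFunction hg
  · rw [e]
    exact H.integral_le_lintegral_snd hc i g hg

theorem map_fst_le (H : SatisfiesDualityInequality c μ D lam π) [ProperSpace X]
    [IsFiniteMeasure lam] [∀ i, IsFiniteMeasureOnCompacts (π i)] (i : Fin K) :
    (π i).map Prod.fst ≤ lam := by
  have := H.isFiniteMeasure i
  refine Measure.le_of_forall_compactlySupported _ _ fun g hg => ?_
  have e : ∫⁻ x, ENNReal.ofReal (g x) ∂((π i).map Prod.fst) =
      ∫⁻ p, ENNReal.ofReal (g p.1) ∂(π i) :=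
    lintegral_map g.continuous.measurable.ennreal_ofReal measurable_fst
  rw [ofReal_integral_compactlySupported _ g hg, ← ofReal_integral_compactlySupported lam g hg, e]
  exact H.lintegral_fst_le i g hg

theorem add_sum_lintegral_le (H : SatisfiesDualityInequality c μ D lam π) [ProperSpace X]
    (hc : LowerSemicontinuous fun p : X × X => c p.1 p.2) [IsFiniteMeasureOnCompacts lam]
    [∀ i, IsFiniteMeasureOnCompacts (π i)] :
    lam Set.univ + ∑ i, ∫⁻ p, c p.1 p.2 ∂(π i) ≤ ENNReal.ofReal D := by
  obtain ⟨u, hu0, hule, hu⟩ := exists_seq_compactlySupported_tendsto_lintegral lam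
    (lowerSemicontinuous_const (z := (1 : ℝ≥0∞)))
  choose w hw0 hwle hw using fun i => exists_seq_compactlySupported_tendsto_lintegral (π i) hc
  rw [lintegral_one] at hu
  refine le_of_tendsto' (hu.add (tendsto_finsetSum Finset.univ fun i _ => hw i)) fun n => ?_
  rw [← ENNReal.ofReal_sum_of_nonneg fun i _ => integral_nonneg (hw0 i n),
    ← ENNReal.ofReal_add (integral_nonneg (hu0 n))
      (Finset.sum_nonneg fun i _ => integral_nonneg (hw0 i n))]
  refine ENNReal.ofReal_le_ofReal ?_
  -- With `s = 1` and `φ = f = 0`, subordination reduces to `u ≤ 1` and `w i ≤ c`.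
  have h := H 1 0 0 (u n) (fun i => w i n) ⟨zero_le_one, fun i x => le_rfl, fun x => ?_,
    fun i x' x => ?_⟩
  · simpa using h
  · simpa using ENNReal.ofReal_le_one.1 (hule n x)
  · simpa using hwle i n (x', x)

theorem barycenterValue_le (H : SatisfiesDualityInequality c μ D lam π)
    (hc : IsAdmissibleCost c) [∀ i, IsFiniteMeasure (μ i)] [IsFiniteMeasureOnCompacts lam]
    [∀ i, IsFiniteMeasureOnCompacts (π i)] : barycenterValue c μ ≤ ENNReal.ofReal D := by
  have := hc.properSpace
  have hsum := H.add_sum_lintegral_le hc.lsc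
  have hlam : IsFiniteMeasure lam :=
    ⟨(le_self_add.trans hsum).trans_lt ENNReal.ofReal_lt_top⟩
  have hπ := H.isFiniteMeasure
  refine le_trans (iInf_le_of_le ⟨lam, hlam⟩ <| iInf_le_of_le
    (fun i => ⟨(π i).map Prod.fst, inferInstance⟩) <| iInf_le _ fun i => H.map_fst_le i)
    (le_trans ?_ hsum)
  refine add_le_add le_rfl (Finset.sum_le_sum fun i _ => ?_)
  exact iInf₂_le (π i) ⟨rfl, H.map_snd_eq hc i⟩

end SatisfiesDualityInequality

end StrongDuality

/-! ### Finiteness and the closing inequality -/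

/-- The data themselves compete: `lam = ∑ μ i`, with diagonal couplings of zero cost. -/
theorem barycenterValue_ne_top {X : Type*} [MeasurableSpace X] {K : ℕ} {c : X → X → ℝ≥0∞}
    (hc0 : ∀ x, c x x = 0) (hcm : Measurable fun p : X × X => c p.1 p.2)
    (μ : Fin K → Measure X) [∀ i, IsFiniteMeasure (μ i)] : barycenterValue c μ ≠ ∞ := by
  have hdiag : Measurable fun x : X => (x, x) := measurable_id.prodMk measurable_id
  have hT : ∀ i, transportCost c (μ i) (μ i) = 0 := fun i => by
    refine nonpos_iff_eq_zero.1 ((iInf₂_le ((μ i).map fun x => (x, x)) ⟨?_, ?_⟩).trans ?_)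
    · exact (lintegral_map hcm hdiag).trans_le (by simp [hc0])
    · exact (Measure.map_map measurable_fst hdiag).trans Measure.map_id
    · exact (Measure.map_map measurable_snd hdiag).trans Measure.map_id
  let lam : FiniteMeasure X := ⟨∑ i, μ i, inferInstance⟩
  let ν : Fin K → FiniteMeasure X := fun i => ⟨μ i, inferInstance⟩
  have hν : ∀ i, (ν i : Measure X) ≤ (lam : Measure X) := fun i =>
    Finset.single_le_sum (f := μ) (fun _ _ => Measure.zero_le _) (Finset.mem_univ i)
  refine ne_top_of_le_ne_top (measure_ne_top (lam : Measure X) Set.univ)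
    ((iInf_le_of_le lam <| iInf_le_of_le ν <| iInf_le _ hν).trans (le_of_eq ?_))
  have hT' : ∀ i, transportCost c (ν i : Measure X) (μ i) = 0 := hT
  simp [hT']

theorem sum_integral_le_of_isSubordinate {X : Type*} [MetricSpace X] [MeasurableSpace X]
    [BorelSpace X] {K : ℕ} {c : X → X → ℝ≥0∞} (hc : IsAdmissibleCost c)
    {μ : Fin K → Measure X} [∀ i, IsFiniteMeasure (μ i)] {D : ℝ}
    (hD : barycenterDualValue c μ ≤ D) {s : ℝ}
    {φ f : Fin K → BoundedContinuousFunction X ℝ} (h : IsSubordinate c s φ f 0 0) :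
    ∑ i, ∫ x, φ i x ∂(μ i) ≤ s * D := by
  have hsum : ∀ x, ∑ i, f i x ≤ s := fun x => by simpa using h.add_sum_le x
  have hle : ∀ i x' x, ENNReal.ofReal (φ i x - f i x') ≤ ENNReal.ofReal s * c x' x :=
    fun i x' x => by simpa using h.ofReal_le i x' x
  -- For `s = 0` the `f i` vanish and the constraint on the diagonal gives `φ i ≤ 0`. For `s > 0`,
  -- division by `s` gives a feasible family `F` with `φ i ≤ s * (F i)^c`.
  rcases h.nonneg.eq_or_lt with rfl | hs
  · rw [zero_mul]
    refine Finset.sum_nonpos fun i _ => integral_nonpos fun x => ?_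
    have h1 : f i x ≤ 0 :=
      (Finset.single_le_sum (fun j _ => h.nonneg_left j x) (Finset.mem_univ i)).trans (hsum x)
    have h2 : φ i x - f i x ≤ 0 := by simpa [ENNReal.ofReal_eq_zero] using hle i x x
    change φ i x ≤ 0
    linarith
  · let F : Fin K → BoundedContinuousFunction X ℝ := fun i => s⁻¹ • f i
    have hF : ∀ i x, F i x = s⁻¹ * f i x := fun i x => rfl
    have hfeas : IsBarycenterDualFeasible F := by
      refine ⟨fun i x => mul_nonneg (inv_nonneg.2 hs.le) (h.nonneg_left i x), fun x => ?_⟩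
      simp only [hF, ← Finset.mul_sum]
      rw [inv_mul_le_iff₀ hs, mul_one]
      exact hsum x
    have hval := (le_iSup₂ (f := fun (f : Fin K → BoundedContinuousFunction X ℝ)
      (_ : IsBarycenterDualFeasible f) =>
      ((∑ i, ∫ x, (cTransform c (f i) x).toReal ∂(μ i) : ℝ) : EReal)) _ hfeas).trans hD
    rw [EReal.coe_le_coe_iff] at hval
    have hφ : ∀ i x, φ i x ≤ s * (cTransform c (F i) x).toReal := fun i x => by
      rw [← inv_mul_le_iff₀ hs, ← EReal.coe_le_coe_iff, coe_toReal_cTransform (F i) hc]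
      refine le_cTransform fun x' => ?_
      rw [hF, ← mul_sub, ENNReal.ofReal_mul (inv_nonneg.2 hs.le), ENNReal.ofReal_inv_of_pos hs]
      have hs0 : ENNReal.ofReal s ≠ 0 := (ENNReal.ofReal_pos.2 hs).ne'
      calc (ENNReal.ofReal s)⁻¹ * ENNReal.ofReal (φ i x - f i x')
          ≤ (ENNReal.ofReal s)⁻¹ * (ENNReal.ofReal s * c x' x) := by gcongr; exact hle i x' x
        _ = c x' x := by
          rw [← mul_assoc, ENNReal.inv_mul_cancel hs0 ENNReal.ofReal_ne_top, one_mul]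
    calc ∑ i, ∫ x, φ i x ∂(μ i)
        ≤ ∑ i, ∫ x, s * (cTransform c (F i) x).toReal ∂(μ i) :=
          Finset.sum_le_sum fun i _ => integral_mono ((φ i).integrable _)
            ((integrable_toReal_cTransform (F i) hc _).const_mul s) (hφ i)
      _ = s * ∑ i, ∫ x, (cTransform c (F i) x).toReal ∂(μ i) := by
          simp_rw [integral_const_mul, Finset.mul_sum]
      _ ≤ s * D := by gcongr

theorem zero_le_barycenterDualValue {X : Type*} [TopologicalSpace X] [MeasurableSpace X] {K : ℕ}
    (c : X → X → ℝ≥0∞) (μ : Fin K → Measure X) :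
    0 ≤ barycenterDualValue c μ := by
  refine le_iSup₂_of_le 0 ⟨fun i x => le_rfl, fun x => by simp⟩ ?_
  rw [← EReal.coe_zero, EReal.coe_le_coe_iff]
  exact Finset.sum_nonneg fun i _ => integral_nonneg fun x => EReal.toReal_nonneg
    (coe_le_cTransform_of_le (a := 0) (fun x' => le_rfl) x)

theorem barycenterValue_le_barycenterDualValue {X : Type*} [MetricSpace X] [MeasurableSpace X]
    [BorelSpace X] {K : ℕ} {c : X → X → ℝ≥0∞} (hc : IsAdmissibleCost c)
    (μ : Fin K → Measure X) [∀ i, IsFiniteMeasure (μ i)]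
    (hfin : barycenterDualValue c μ ≠ ⊤) :
    ((barycenterValue c μ : ℝ≥0∞) : EReal) ≤ barycenterDualValue c μ := by
  have := hc.properSpace
  have h0 := zero_le_barycenterDualValue c μ
  have hD : ((barycenterDualValue c μ).toReal : EReal) = barycenterDualValue c μ :=
    EReal.coe_toReal hfin (EReal.bot_lt_zero.trans_le h0).ne'
  obtain ⟨lam, π, hlam, hπ, H⟩ := exists_measures_of_dual_bound c μ
    (barycenterDualValue c μ).toReal fun s φ f h => sum_integral_le_of_isSubordinate hc hD.ge h
  have hB := SatisfiesDualityInequality.barycenterValue_le H hc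
  refine (EReal.coe_ennreal_le_coe_ennreal_iff.2 hB).trans (le_of_eq ?_)
  rw [EReal.coe_ennreal_ofReal, max_eq_left (EReal.toReal_nonneg h0), hD]

end

theorem mainTheorem7 {X : Type*} [MetricSpace X] [CompleteSpace X] [SecondCountableTopology X]
    [MeasurableSpace X] [BorelSpace X] (K : ℕ) (hK : 2 ≤ K)
    (c : X → X → ENNReal) (hc : IsAdmissibleCost c)
    (μ : Fin K → MeasureTheory.Measure X) [∀ i, MeasureTheory.IsFiniteMeasure (μ i)] :
    (∀ f : BoundedContinuousFunction X ℝ,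
      (∀ x, cTransform c f x ≠ ⊥ ∧ cTransform c f x ≠ ⊤) ∧
      ∀ i, MeasureTheory.Integrable (fun x => (cTransform c f x).toReal) (μ i)) ∧
    barycenterDualValue c μ = ((barycenterValue c μ : ENNReal) : EReal) ∧
    decomposedDualValue c μ = ((barycenterValue c μ : ENNReal) : EReal) ∧
    fullDualValue c μ = ((barycenterValue c μ : ENNReal) : EReal) := by
  have := hc.properSpace
  have h12 := barycenterDualValue_le_decomposedDualValue hc μ
  have h2 := decomposedDualValue_le_barycenterValue hc.lsc μ
  -- Strong duality needs a real bound `D`; weak duality and the finite primal value supply it.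
  have hfin : barycenterDualValue c μ ≠ ⊤ := by
    refine ne_top_of_le_ne_top ?_ (h12.trans h2)
    simpa using barycenterValue_ne_top hc.self_eq_zero hc.lsc.measurable μ
  have h1 := barycenterValue_le_barycenterDualValue hc μ hfin
  refine ⟨fun f => ⟨fun x => ⟨cTransform_ne_bot f x, cTransform_ne_top f hc x⟩,
    fun i => integrable_toReal_cTransform f hc (μ i)⟩, le_antisymm (h12.trans h2) h1,
    le_antisymm h2 (h1.trans h12), ?_⟩
  rw [fullDualValue_eq_decomposedDualValue]
  exact le_antisymm h2 (h1.trans h12)
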